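/- **Setting.** Let $\mathcal A$ be a finite set of arms and let $\theta^*\in\mathbb R^d$ be one coefficient vector shared by all arms. In round $t=1,\dots,T$ one observes a nonempty set $\mathcal A_t\subseteq\mathcal A$ of available arms, their feature vectors $x_{t,a}\in\mathbb R^d$ and the sensitive attribute $S_t\in\{s^+,s^-\}$ of the current user, picks an arm $a_t\in\mathcal A_t$ and observes the reward $r_t=\langle\theta^*,x_{t,a_t}\rangle+\epsilon_t$. Let $(\mathcal F_t)_{t\ge 0}$ be a filtration such that $\mathcal A_t$, $x_{t,a}$, $S_t$, $\alpha_t$, $a_t$ are $\mathcal F_{t-1}$-measurable and $\epsilon_t$ is $\mathcal F_t$-measurable. For a positive definite matrix $A$ write $\|x\|_A=\sqrt{x^{\mathsf T}Ax}$. **Algorithm (Fair-LinUCB with parameters $\lambda>0$, $\gamma\ge 0$, $\alpha_t$).** Put $A_t=\lambda I_d+\sum_{i<t}x_{i,a_i}x_{i,a_i}^{\mathsf T}$, $b_t=\sum_{i<t}r_i x_{i,a_i}$ and $\hat\theta_t=A_t^{-1}b_t$. Let $\bar r^{s}$ be the mean of the rewards $r_i$ over the rounds $i<t$ with $S_i=s$,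 and $\bar r^{s}_a$ the mean over those of them with $a_i=a$ (an empty mean is $0$). Put $F_{t,a}=-\operatorname{sign}(\bar r^{s^+}-\bar r^{s^-})\,(\bar r_a^{s^+}-\bar r_a^{s^-})$ and $$\mathcal L_t(\gamma,F_{t,a})=\tfrac12\,\alpha_t\,\|x_{t,a_m}\|_{A_t^{-1}}\,(F_{t,a}+1)\,\gamma ,\qquad a_m\in\operatorname*{argmin}_{a\in\mathcal A_t}\|x_{t,a}\|_{A_t^{-1}} .$$ The algorithm picks $a_t\in\operatorname{argmax}_{a\in\mathcal A_t}\big(\hat\theta_t^{\mathsf T}x_{t,a}+\alpha_t\|x_{t,a}\|_{A_t^{-1}}+\mathcal L_t(\gamma,F_{t,a})\big)$, with ties broken arbitrarily. Its cumulative regret is $R_T=\sum_{t=1}^T\big(\max_{a\in\mathcal A_t}\langle\theta^*,x_{t,a}\rangle-\langle\theta^*,x_{t,a_t}\rangle\big)$. **Theorem.** Let $\delta\in(0,1)$ and $0\le\gamma\le\Gamma$, and suppose that - the noise is conditionally 1-sub-Gaussian: $\mathbb E[e^{s\epsilon_t}\mid\mathcal F_{t-1}]\le e^{s^2/2}$ for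 all $s\in\mathbb R$ and all $t$; - $\|x_{t,a}\|_2<L$ for all $t$ and all $a\in\mathcal A_t$, $\|\theta^*\|_2<M$, and $\lambda\ge L^2$; - the observed rewards $r_t$ lie in $[0,1]$ almost surely; - $(\alpha_t)$ is non-decreasing with $\alpha_1\ge 1$, and for all $t\le T$ $$\sqrt\lambda\,\|\theta^*\|_2+\sqrt{2\log\big(|A_t|^{1/2}|\lambda I_d|^{-1/2}\delta^{-1}\big)}\;\le\;\alpha_t\;\le\;\sqrt\lambda M+\sqrt{2\log(1/\delta)+d\log\big(1+TL^2/(d\lambda)\big)} .$$ Then, almost surely, $\mathcal L_t(\gamma,F_{t,a})\in[0,\gamma\,\alpha_t\|x_{t,a_m}\|_{A_t^{-1}}]$ for all $t\le T$ and $a\in\mathcal A_t$, and with probability at least $1-\delta$ $$R_T\le\sqrt{2Td\log\big(1+TL^2/(d\lambda)\big)}\;(2+\Gamma)\Big(\sqrt\lambda M+\sqrt{2\log(1/\delta)+d\log\big(1+TL^2/(d\lambda)\big)}\Big).$$ -/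

import Mathlib

open MeasureTheory
open scoped Matrix

noncomputable section

namespace FairBandit

/-- A linear contextual bandit with `d`-dimensional contexts on a sample space `Ω`, with one
coefficient vector shared by all arms. Rounds are indexed from `0`: index `t` is round `t + 1`. -/
structure LinearBandit (Ω 𝒜 : Type*) (d : ℕ) where
  /-- the arms available in each round -/
  arms : ℕ → Ω → Finset 𝒜
  arms_nonempty : ∀ t ω, (arms t ω).Nonempty
  /-- the feature vector of each arm in each round -/
  ctx : ℕ → Ω → 𝒜 → EuclideanSpace ℝ (Fin d)
  /-- the sensitive attribute of the user of each round; `true` is the privileged group -/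
  group : ℕ → Ω → Bool
  /-- the true coefficient vector -/
  theta : EuclideanSpace ℝ (Fin d)
  /-- the noise in the observed reward of each round -/
  noise : ℕ → Ω → ℝ

/-- The weighted 2-norm `√(vᵀ A v)`. -/
def weightedNorm {d : ℕ} (A : Matrix (Fin d) (Fin d) ℝ) (v : EuclideanSpace ℝ (Fin d)) : ℝ :=
  √(v.ofLp ⬝ᵥ (A *ᵥ v.ofLp))

/-- The noise is conditionally 1-sub-Gaussian: given the history before round `t`, the moment
generating function of `ε t` is at most `exp (s ^ 2 / 2)`. -/
def CondSubGaussian {Ω : Type*} [mΩ : MeasurableSpace Ω] (μ : Measure Ω) (ℱ : Filtration ℕ mΩ)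
    (ε : ℕ → Ω → ℝ) : Prop :=
  ∀ (t : ℕ) (s : ℝ), Integrable (fun ω => Real.exp (s * ε t ω)) μ ∧
    μ[fun ω => Real.exp (s * ε t ω) | ℱ t] ≤ᵐ[μ] fun _ => Real.exp (s ^ 2 / 2)

namespace LinearBandit

variable {Ω 𝒜 : Type*} {d : ℕ} (B : LinearBandit Ω 𝒜 d)

/-- `ℱ t` is the information available when the arm `play t` of index `t` is picked: it contains
everything observed in the earlier rounds, and the contexts, the available arms, the sensitive
attribute and the exploration parameter of index `t`. -/
structure Adapted [mΩ : MeasurableSpace Ω] (ℱ : Filtration ℕ mΩ) (α : ℕ → Ω → ℝ)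
    (play : ℕ → Ω → 𝒜) : Prop where
  arms : ∀ t a, MeasurableSet[ℱ t] {ω | a ∈ B.arms t ω}
  ctx : ∀ t a, Measurable[ℱ t] fun ω => B.ctx t ω a
  group : ∀ t, Measurable[ℱ t] (B.group t)
  alpha : ∀ t, Measurable[ℱ t] (α t)
  play : ∀ t a, MeasurableSet[ℱ t] {ω | play t ω = a}
  noise : ∀ t, Measurable[ℱ (t + 1)] (B.noise t)

/-- The reward observed at index `t` if the arms `play` are picked. -/
def reward (play : ℕ → Ω → 𝒜) (t : ℕ) (ω : Ω) : ℝ :=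
  inner ℝ B.theta (B.ctx t ω (play t ω)) + B.noise t ω

/-- The matrix `A = lam I + ∑ x xᵀ`, the sum being over the rounds before index `t`. -/
def design (lam : ℝ) (play : ℕ → Ω → 𝒜) (t : ℕ) (ω : Ω) : Matrix (Fin d) (Fin d) ℝ :=
  lam • 1 + ∑ i ∈ Finset.range t,
    Matrix.vecMulVec (B.ctx i ω (play i ω)).ofLp (B.ctx i ω (play i ω)).ofLp

/-- The vector `b = ∑ r x`, the sum being over the rounds before index `t`. -/
def response (play : ℕ → Ω → 𝒜) (t : ℕ) (ω : Ω) : EuclideanSpace ℝ (Fin d) :=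
  ∑ i ∈ Finset.range t, B.reward play i ω • B.ctx i ω (play i ω)

/-- The ridge regression estimate `A⁻¹ b`. -/
def estimate (lam : ℝ) (play : ℕ → Ω → 𝒜) (t : ℕ) (ω : Ω) : EuclideanSpace ℝ (Fin d) :=
  WithLp.toLp 2 ((B.design lam play t ω)⁻¹ *ᵥ (B.response play t ω).ofLp)

/-- The width `‖x_{t,a}‖_{A⁻¹}`. -/
def width (lam : ℝ) (play : ℕ → Ω → 𝒜) (t : ℕ) (ω : Ω) (a : 𝒜) : ℝ :=
  weightedNorm (B.design lam play t ω)⁻¹ (B.ctx t ω a)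

/-- The smallest width among the available arms, `‖x_{t,a_m}‖_{A⁻¹}`. -/
def minWidth (lam : ℝ) (play : ℕ → Ω → 𝒜) (t : ℕ) (ω : Ω) : ℝ :=
  (B.arms t ω).inf' (B.arms_nonempty t ω) (B.width lam play t ω)

/-- The mean reward, before index `t`, of the users of group `s`; it is `0` if there are none. -/
def groupMean (play : ℕ → Ω → 𝒜) (s : Bool) (t : ℕ) (ω : Ω) : ℝ :=
  let I := (Finset.range t).filter fun i => B.group i ω = s
  (∑ i ∈ I, B.reward play i ω) / (I.card : ℝ)

open Classical in
/-- The mean reward, before index `t`, of the users of group `s` who were given the arm `a`; it is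
`0` if there are none. -/
def armGroupMean (play : ℕ → Ω → 𝒜) (s : Bool) (a : 𝒜) (t : ℕ) (ω : Ω) : ℝ :=
  let I := (Finset.range t).filter fun i => B.group i ω = s ∧ play i ω = a
  (∑ i ∈ I, B.reward play i ω) / (I.card : ℝ)

/-- The fairness penalty `F_a`. -/
def penalty (play : ℕ → Ω → 𝒜) (t : ℕ) (ω : Ω) (a : 𝒜) : ℝ :=
  -Real.sign (B.groupMean play true t ω - B.groupMean play false t ω) *
    (B.armGroupMean play true a t ω - B.armGroupMean play false a t ω)

/-- The rescaled fairness penalty `(α_t ‖x_{t,a_m}‖_{A⁻¹} / 2) (F_a + 1) γ`. -/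
def scaledPenalty (lam γ : ℝ) (α : ℕ → Ω → ℝ) (play : ℕ → Ω → 𝒜) (t : ℕ) (ω : Ω) (a : 𝒜) : ℝ :=
  α t ω * B.minWidth lam play t ω / 2 * (B.penalty play t ω a + 1) * γ

/-- The index `p_{t,a}` that Fair-LinUCB maximizes. -/
def score (lam γ : ℝ) (α : ℕ → Ω → ℝ) (play : ℕ → Ω → 𝒜) (t : ℕ) (ω : Ω) (a : 𝒜) : ℝ :=
  inner ℝ (B.estimate lam play t ω) (B.ctx t ω a) + α t ω * B.width lam play t ω a +
    B.scaledPenalty lam γ α play t ω a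

/-- `play` is a run of Fair-LinUCB over `T` rounds: each arm picked is available and maximizes the
score; ties are broken arbitrarily. -/
def IsFairLinUCB (lam γ : ℝ) (α : ℕ → Ω → ℝ) (T : ℕ) (play : ℕ → Ω → 𝒜) : Prop :=
  ∀ t < T, ∀ ω, play t ω ∈ B.arms t ω ∧
    ∀ a ∈ B.arms t ω, B.score lam γ α play t ω a ≤ B.score lam γ α play t ω (play t ω)

/-- The data-dependent radius `√lam ‖θ*‖ + √(2 log (|A|^(1/2) |lam I|^(-1/2) δ⁻¹))` of the
confidence ellipsoid at index `t`. -/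
def confRadius (lam δ : ℝ) (play : ℕ → Ω → 𝒜) (t : ℕ) (ω : Ω) : ℝ :=
  √lam * ‖B.theta‖ + √(2 * Real.log (√((B.design lam play t ω).det / lam ^ d) / δ))

/-- The cumulative regret over `T` rounds: the sum of the gaps between the expected reward of the
best available arm and that of the arm picked. -/
def regret (play : ℕ → Ω → 𝒜) (T : ℕ) (ω : Ω) : ℝ :=
  ∑ t ∈ Finset.range T,
    ((B.arms t ω).sup' (B.arms_nonempty t ω) (fun a => inner ℝ B.theta (B.ctx t ω a)) -
      inner ℝ B.theta (B.ctx t ω (play t ω)))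

end LinearBandit

/-- The deterministic confidence radius `√lam M + √(2 log (1/δ) + d log (1 + T L² / (d lam)))`. -/
def finalRadius (d T : ℕ) (lam L M δ : ℝ) : ℝ :=
  √lam * M + √(2 * Real.log (1 / δ) + d * Real.log (1 + T * L ^ 2 / (d * lam)))

end FairBandit

end

/-! This is the optimism argument for linear bandits with a bounded perturbation of the index.
Rewards lie in `[0,1]`, so `|F_a| ≤ 1` and the rescaled penalty lies between `0` and `γ α_t` times
the smallest width. If `α_t` dominates the estimation error, the index of every arm is at least its
true mean, because the penalty is nonnegative. The arm picked exceeds its own mean by at most two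
confidence widths plus `γ` times one, since the smallest width is at most its own. A round therefore
costs at most `(2 + γ) α_t ‖x‖_{A⁻¹}`. Cauchy–Schwarz over the rounds and the elliptical potential
bound on the sum of squared widths give the rate.

The probabilistic part is that the confidence ellipsoids hold at all times simultaneously. With `S =
∑ ε x`, put `D = |A|^(-1/2) |lam I|^(1/2) exp (‖S‖²_{A⁻¹} / 2)`. For `p = ⟨x, A⁻¹ S⟩` and `q = ⟨x,
A⁻¹ x⟩`, Sherman–Morrison and the determinant lemma show that one round multiplies `D` by `exp (p ε
/ (1 + q) + q ε² / (2 (1 + q)))` over `√(1 + q) exp (p² / (2 (1 + q)))`. The numerator is the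
average of `exp (s ε)` over a scalar Gaussian `s` whose mean and variance are known before the
round; averaging the sub-Gaussian bound `exp (s² / 2)` gives exactly the denominator. So `D` is a
supermartingale started at `1`, and Ville's inequality keeps it below `1 / δ` with probability at
least `1 - δ`. -/

namespace FairBandit

/-! ### Positive definite forms, rank-one updates and determinants. -/

section QuadraticForms

variable {n : Type*} [Fintype n]

theorem dotProduct_mulVec_comm {P : Matrix n n ℝ} (hP : P.IsHermitian) (x y : n → ℝ) :
    x ⬝ᵥ (P *ᵥ y) = y ⬝ᵥ (P *ᵥ x) := by
  have hT : Pᵀ = P := by simpa [Matrix.conjTranspose_eq_transpose_of_trivial] using hP.eq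
  rw [Matrix.dotProduct_mulVec, dotProduct_comm, ← Matrix.mulVec_transpose, hT]

theorem dotProduct_mulVec_self_nonneg {P : Matrix n n ℝ} (hP : P.PosSemidef) (x : n → ℝ) :
    0 ≤ x ⬝ᵥ (P *ᵥ x) := by
  simpa using hP.dotProduct_mulVec_nonneg x

/-- The Cauchy–Schwarz inequality for a positive semidefinite form. -/
theorem sq_dotProduct_mulVec_le {P : Matrix n n ℝ} (hP : P.PosSemidef) (x y : n → ℝ) :
    (x ⬝ᵥ (P *ᵥ y)) ^ 2 ≤ (x ⬝ᵥ (P *ᵥ x)) * (y ⬝ᵥ (P *ᵥ y)) := by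
  have h : discrim (y ⬝ᵥ (P *ᵥ y)) (2 * (x ⬝ᵥ (P *ᵥ y))) (x ⬝ᵥ (P *ᵥ x)) ≤ 0 := by
    refine discrim_le_zero fun t => ?_
    have h := dotProduct_mulVec_self_nonneg hP (x + t • y)
    simp only [Matrix.mulVec_add, Matrix.mulVec_smul, dotProduct_add, add_dotProduct,
      smul_dotProduct, dotProduct_smul, smul_eq_mul, dotProduct_mulVec_comm hP.1 y x] at h
    linarith
  rw [discrim] at h
  linarith

theorem posSemidef_vecMulVec_self (x : n → ℝ) : (Matrix.vecMulVec x x).PosSemidef := by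
  simpa using Matrix.posSemidef_vecMulVec_self_star x

theorem measurable_dotProduct_mulVec {Ω : Type*} {_ : MeasurableSpace Ω} {P : Ω → Matrix n n ℝ}
    {x y : Ω → n → ℝ} (hP : ∀ i j, Measurable fun ω => P ω i j)
    (hx : ∀ i, Measurable fun ω => x ω i) (hy : ∀ i, Measurable fun ω => y ω i) :
    Measurable fun ω => x ω ⬝ᵥ (P ω *ᵥ y ω) := by
  simp only [dotProduct, Matrix.mulVec]
  fun_prop

theorem posDef_add_vecMulVec_self {A : Matrix n n ℝ} (hA : A.PosDef) (x : n → ℝ) :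
    (A + Matrix.vecMulVec x x).PosDef :=
  hA.add_posSemidef (posSemidef_vecMulVec_self x)

variable [DecidableEq n]

theorem mulVec_inv_mulVec {A : Matrix n n ℝ} (hA : A.PosDef) (y : n → ℝ) :
    A *ᵥ (A⁻¹ *ᵥ y) = y := by
  rw [Matrix.mulVec_mulVec, Matrix.mul_nonsing_inv _ ((Matrix.isUnit_iff_isUnit_det _).1 hA.isUnit),
    Matrix.one_mulVec]

theorem inv_mulVec_mulVec {A : Matrix n n ℝ} (hA : A.PosDef) (y : n → ℝ) :
    A⁻¹ *ᵥ (A *ᵥ y) = y := by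
  rw [Matrix.mulVec_mulVec, Matrix.nonsing_inv_mul _ ((Matrix.isUnit_iff_isUnit_det _).1 hA.isUnit),
    Matrix.one_mulVec]

/-- The Sherman–Morrison formula, applied to a vector. -/
theorem inv_add_vecMulVec_mulVec {A : Matrix n n ℝ} (hA : A.PosDef) (x y : n → ℝ) :
    (A + Matrix.vecMulVec x x)⁻¹ *ᵥ y =
      A⁻¹ *ᵥ y - ((x ⬝ᵥ (A⁻¹ *ᵥ y)) / (1 + x ⬝ᵥ (A⁻¹ *ᵥ x))) • (A⁻¹ *ᵥ x) := by
  have hq := dotProduct_mulVec_self_nonneg hA.inv.posSemidef x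
  have hq' : 1 + x ⬝ᵥ (A⁻¹ *ᵥ x) ≠ 0 := by positivity
  -- It suffices that `A + x xᵀ` maps the claimed right-hand side to `y`.
  rw [← inv_mulVec_mulVec (posDef_add_vecMulVec_self hA x)
    (A⁻¹ *ᵥ y - ((x ⬝ᵥ (A⁻¹ *ᵥ y)) / (1 + x ⬝ᵥ (A⁻¹ *ᵥ x))) • (A⁻¹ *ᵥ x))]
  congr 1
  rw [Matrix.add_mulVec, Matrix.vecMulVec_mulVec, Matrix.mulVec_sub, Matrix.mulVec_smul,
    mulVec_inv_mulVec hA, mulVec_inv_mulVec hA, dotProduct_sub, dotProduct_smul]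
  ext i
  simp only [Pi.add_apply, Pi.sub_apply, Pi.smul_apply, smul_eq_mul, MulOpposite.smul_eq_mul_unop,
    MulOpposite.unop_op]
  field_simp
  ring

/-- The quadratic form of the inverse after a rank-one update of the matrix and a shift of the
argument in the same direction. -/
theorem dotProduct_inv_add_vecMulVec_mulVec {A : Matrix n n ℝ} (hA : A.PosDef) (x y : n → ℝ)
    (e : ℝ) :
    (y + e • x) ⬝ᵥ ((A + Matrix.vecMulVec x x)⁻¹ *ᵥ (y + e • x)) =
      y ⬝ᵥ (A⁻¹ *ᵥ y) - (x ⬝ᵥ (A⁻¹ *ᵥ y)) ^ 2 / (1 + x ⬝ᵥ (A⁻¹ *ᵥ x)) +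
      2 * ((x ⬝ᵥ (A⁻¹ *ᵥ y)) / (1 + x ⬝ᵥ (A⁻¹ *ᵥ x)) * e) +
      (x ⬝ᵥ (A⁻¹ *ᵥ x)) / (1 + x ⬝ᵥ (A⁻¹ *ᵥ x)) * e ^ 2 := by
  have hq := dotProduct_mulVec_self_nonneg hA.inv.posSemidef x
  have hq' : 1 + x ⬝ᵥ (A⁻¹ *ᵥ x) ≠ 0 := by positivity
  rw [inv_add_vecMulVec_mulVec hA]
  simp only [Matrix.mulVec_add, Matrix.mulVec_smul, dotProduct_add, add_dotProduct, dotProduct_sub,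
    smul_dotProduct, dotProduct_smul, smul_eq_mul, dotProduct_mulVec_comm hA.inv.1 y x]
  field_simp
  ring

/-- The matrix determinant lemma. -/
theorem det_add_vecMulVec_self {A : Matrix n n ℝ} (hA : A.PosDef) (x : n → ℝ) :
    (A + Matrix.vecMulVec x x).det = A.det * (1 + x ⬝ᵥ (A⁻¹ *ᵥ x)) := by
  rw [Matrix.vecMulVec_eq Unit,
    Matrix.det_add_replicateCol_mul_replicateRow ((Matrix.isUnit_iff_isUnit_det _).1 hA.isUnit),
    Matrix.mul_assoc, Matrix.det_unique (n := Unit)]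
  congr 2

/-- If `c I ≤ A` then `A⁻¹ ≤ c⁻¹ I`. -/
theorem dotProduct_inv_mulVec_le {A : Matrix n n ℝ} (hA : A.PosDef) {c : ℝ} (hc : 0 < c)
    (h : ∀ y : n → ℝ, c * (y ⬝ᵥ y) ≤ y ⬝ᵥ (A *ᵥ y)) (x : n → ℝ) :
    x ⬝ᵥ (A⁻¹ *ᵥ x) ≤ (x ⬝ᵥ x) / c := by
  have h1 := h (A⁻¹ *ᵥ x)
  rw [mulVec_inv_mulVec hA, dotProduct_comm (A⁻¹ *ᵥ x) x] at h1
  have h2 := sq_dotProduct_mulVec_le (P := (1 : Matrix n n ℝ)) Matrix.PosSemidef.one x (A⁻¹ *ᵥ x)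
  simp only [Matrix.one_mulVec] at h2
  have h3 := dotProduct_mulVec_self_nonneg hA.inv.posSemidef x
  have h4 : 0 ≤ x ⬝ᵥ x := by simpa using dotProduct_star_self_nonneg x
  rw [le_div_iff₀ hc]
  -- With `u = x ⬝ᵥ A⁻¹ x`, the facts above give `c u² ≤ (x ⬝ᵥ x) u`; one factor `u` is cancelled,
  -- so `u = 0` is treated separately.
  rcases h3.eq_or_lt with h0 | h0
  · rw [← h0]; simpa using h4
  · refine le_of_mul_le_mul_left ?_ h0
    nlinarith [mul_le_mul_of_nonneg_left h1 h4]

/-- The determinant of a positive definite matrix is at most the power of its mean eigenvalue. -/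
theorem det_le_trace_div_card_pow [Nonempty n] {A : Matrix n n ℝ} (hA : A.PosDef) :
    A.det ≤ (A.trace / Fintype.card n) ^ Fintype.card n := by
  have hcard : (Fintype.card n : ℝ) ≠ 0 := by positivity
  have hev : ∀ i, 0 ≤ hA.1.eigenvalues i := fun i => (hA.eigenvalues_pos i).le
  have hdet : A.det = ∏ i, hA.1.eigenvalues i := by simpa using hA.1.det_eq_prod_eigenvalues
  have htr : A.trace = ∑ i, hA.1.eigenvalues i := by simpa using hA.1.trace_eq_sum_eigenvalues
  -- AM–GM for the eigenvalues.
  have h := Real.geom_mean_le_arith_mean_weighted Finset.univ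
    (fun _ => (Fintype.card n : ℝ)⁻¹) hA.1.eigenvalues (fun _ _ => by positivity)
    (by simp [hcard]) (fun i _ => hev i)
  rw [Real.finsetProd_rpow _ _ (fun i _ => hev i), ← hdet, ← Finset.mul_sum, ← htr] at h
  have h' := pow_le_pow_left₀ (Real.rpow_nonneg hA.det_pos.le _) h (Fintype.card n)
  rwa [Real.rpow_inv_natCast_pow hA.det_pos.le Fintype.card_ne_zero, inv_mul_eq_div] at h'

theorem measurable_det_of_apply {Ω : Type*} {_ : MeasurableSpace Ω} {A : Ω → Matrix n n ℝ}
    (hA : ∀ i j, Measurable fun ω => A ω i j) : Measurable fun ω => (A ω).det := by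
  simp only [Matrix.det_apply]
  fun_prop

theorem measurable_inv_apply {Ω : Type*} {_ : MeasurableSpace Ω} {A : Ω → Matrix n n ℝ}
    (hA : ∀ i j, Measurable fun ω => A ω i j) (i j : n) :
    Measurable fun ω => (A ω)⁻¹ i j := by
  simp only [Matrix.inv_def, Matrix.smul_apply, Ring.inverse_eq_inv', smul_eq_mul,
    Matrix.adjugate_apply]
  refine (measurable_det_of_apply hA).inv.mul (measurable_det_of_apply fun k l => ?_)
  -- A cofactor is the determinant of `A` with row `j` replaced by a constant row.
  by_cases hk : k = j
  · subst hk; simp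
  · simpa [Matrix.updateRow_ne hk] using hA k l

end QuadraticForms

/-! ### Conditional sub-Gaussian bounds, Gaussian averaging and Ville's inequality. -/

section Probability

open ProbabilityTheory Filter
open scoped ENNReal NNReal Topology

theorem lintegral_exp_mul_gaussianReal (s : ℝ) :
    ∫⁻ g, ENNReal.ofReal (Real.exp (s * g)) ∂(gaussianReal 0 1) =
      ENNReal.ofReal (Real.exp (s ^ 2 / 2)) := by
  rw [← ofReal_integral_eq_lintegral_ofReal (integrable_exp_mul_gaussianReal s)
    (ae_of_all _ fun _ => (Real.exp_pos _).le)]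
  have h := congrFun (mgf_fun_id_gaussianReal (μ := 0) (v := 1)) s
  rw [mgf] at h
  rw [h]
  simp

/-- The Gaussian average of `exp ((u + r g)² / 2)` for `u = p / (1 + q)` and `r² = q / (1 + q)`. -/
theorem lintegral_exp_sq_gaussianReal (p : ℝ) {q : ℝ} (hq : 0 ≤ q) :
    ∫⁻ g, ENNReal.ofReal (Real.exp ((p / (1 + q) + √(q / (1 + q)) * g) ^ 2 / 2))
        ∂(gaussianReal 0 1) =
      ENNReal.ofReal (√(1 + q) * Real.exp (p ^ 2 / (1 + q) / 2)) := by
  have hq1 : 0 < 1 + q := by positivity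
  set r := √(q / (1 + q)) with hr
  have hr2 : r ^ 2 = q / (1 + q) := Real.sq_sqrt (by positivity)
  let v : ℝ≥0 := ⟨1 + q, hq1.le⟩
  have hv : v ≠ 0 := fun h => hq1.ne' (congrArg NNReal.toReal h)
  have hvq : (v : ℝ) = 1 + q := rfl
  rw [gaussianReal_of_var_ne_zero 0 one_ne_zero,
    lintegral_withDensity_eq_lintegral_mul _ (measurable_gaussianPDF 0 1) (by fun_prop)]
  -- Completing the square turns the integrand into a constant times the density of the Gaussian
  -- with mean `p r` and variance `1 + q`.
  have hpt : ∀ g : ℝ, (gaussianPDF 0 1 * fun g => ENNReal.ofReal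
      (Real.exp ((p / (1 + q) + r * g) ^ 2 / 2))) g =
      ENNReal.ofReal (√(1 + q) * Real.exp (p ^ 2 / (1 + q) / 2)) * gaussianPDF (p * r) v g := by
    intro g
    rw [Pi.mul_apply, gaussianPDF, gaussianPDF, ← ENNReal.ofReal_mul (gaussianPDFReal_nonneg _ _ _),
      ← ENNReal.ofReal_mul (by positivity)]
    congr 1
    rw [gaussianPDFReal, gaussianPDFReal, hvq, Real.sqrt_mul (by positivity) (1 + q), mul_assoc,
      ← Real.exp_add]
    have hs : √(1 + q) ≠ 0 := by positivity
    have hexp : -(g - 0) ^ 2 / (2 * ((1 : ℝ≥0) : ℝ)) + (p / (1 + q) + r * g) ^ 2 / 2 =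
        p ^ 2 / (1 + q) / 2 + -(g - p * r) ^ 2 / (2 * (1 + q)) := by
      have e1 : (p / (1 + q) + r * g) ^ 2 =
          p ^ 2 / (1 + q) ^ 2 + 2 * (p * r * g) / (1 + q) + r ^ 2 * g ^ 2 := by
        field_simp; ring
      have e2 : (g - p * r) ^ 2 = g ^ 2 - 2 * (p * r * g) + p ^ 2 * r ^ 2 := by ring
      rw [e1, e2, hr2]
      push_cast
      field_simp
      ring
    rw [hexp, Real.exp_add]
    simp only [NNReal.coe_one, mul_one]
    field_simp
  rw [lintegral_congr hpt, lintegral_const_mul _ (measurable_gaussianPDF _ _),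
    lintegral_gaussianPDF_eq_one _ hv, mul_one]

variable {Ω : Type*} {m mΩ : MeasurableSpace Ω} {μ : Measure Ω} [IsProbabilityMeasure μ]
  {ε : Ω → ℝ}

/-- On `m`-measurable sets the measure with density `exp (s ε - s² / 2)` is at most `μ`, by the
conditional bound. Comparing the trimmed measures then allows any `m`-measurable weight, with no
integrability condition on `W`. -/
theorem lintegral_mul_exp_le_of_condExp_le (hm : m ≤ mΩ) (hε : Measurable[mΩ] ε) {s : ℝ}
    (hint : Integrable (fun ω => Real.exp (s * ε ω)) μ)
    (hle : μ[fun ω => Real.exp (s * ε ω) | m] ≤ᵐ[μ] fun _ => Real.exp (s ^ 2 / 2))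
    {W : Ω → ℝ≥0∞} (hW : Measurable[m] W) :
    ∫⁻ ω, W ω * ENNReal.ofReal (Real.exp (s * ε ω - s ^ 2 / 2)) ∂μ ≤ ∫⁻ ω, W ω ∂μ := by
  set ρ : Ω → ℝ≥0∞ := fun ω => ENNReal.ofReal (Real.exp (s * ε ω - s ^ 2 / 2)) with hρ
  have hρm : Measurable[mΩ] ρ := by fun_prop
  have htrim : (μ.withDensity ρ).trim hm ≤ μ.trim hm := by
    refine Measure.le_iff.2 fun E hE => ?_
    rw [trim_measurableSet_eq hm hE, trim_measurableSet_eq hm hE, withDensity_apply _ (hm _ hE)]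
    have hfac : ∀ ω, ρ ω = ENNReal.ofReal (Real.exp (-(s ^ 2 / 2))) *
        ENNReal.ofReal (Real.exp (s * ε ω)) := fun ω => by
      rw [hρ, ← ENNReal.ofReal_mul (Real.exp_pos _).le, ← Real.exp_add]
      ring_nf
    rw [lintegral_congr hfac, lintegral_const_mul _ (by fun_prop),
      ← ofReal_integral_eq_lintegral_ofReal hint.integrableOn
        (ae_of_all _ fun _ => (Real.exp_pos _).le), ← setIntegral_condExp hm hint hE]
    have h1 : ∫ ω in E, (μ[fun ω => Real.exp (s * ε ω) | m]) ω ∂μ ≤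
        Real.exp (s ^ 2 / 2) * μ.real E := by
      refine (setIntegral_mono_ae integrable_condExp.integrableOn
        (integrable_const _).integrableOn hle).trans_eq ?_
      simp [mul_comm]
    rw [← ENNReal.ofReal_mul (Real.exp_pos _).le]
    refine (ENNReal.ofReal_le_ofReal (mul_le_mul_of_nonneg_left h1 (Real.exp_pos _).le)).trans_eq ?_
    rw [← mul_assoc, ← Real.exp_add]
    simp
  calc ∫⁻ ω, W ω * ρ ω ∂μ = ∫⁻ ω, W ω ∂(μ.withDensity ρ) := by
        rw [lintegral_withDensity_eq_lintegral_mul _ hρm (hW.mono hm le_rfl)]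
        exact lintegral_congr fun ω => mul_comm _ _
    _ = ∫⁻ ω, W ω ∂((μ.withDensity ρ).trim hm) := (lintegral_trim hm hW).symm
    _ ≤ ∫⁻ ω, W ω ∂(μ.trim hm) := lintegral_mono' htrim le_rfl
    _ = ∫⁻ ω, W ω ∂μ := lintegral_trim hm hW

/-- The conditional sub-Gaussian bound at a random parameter `s` known at the time of
conditioning. -/
theorem lintegral_mul_exp_le_of_measurable (hm : m ≤ mΩ) (hε : Measurable[mΩ] ε)
    (hsub : ∀ s : ℝ, Integrable (fun ω => Real.exp (s * ε ω)) μ ∧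
      μ[fun ω => Real.exp (s * ε ω) | m] ≤ᵐ[μ] fun _ => Real.exp (s ^ 2 / 2))
    {s : Ω → ℝ} (hs : Measurable[m] s) {W : Ω → ℝ≥0∞} (hW : Measurable[m] W) :
    ∫⁻ ω, W ω * ENNReal.ofReal (Real.exp (s ω * ε ω)) ∂μ ≤
      ∫⁻ ω, W ω * ENNReal.ofReal (Real.exp (s ω ^ 2 / 2)) ∂μ := by
  -- For a simple parameter, the fixed-`s` bound is applied on each fiber, whose indicator is
  -- absorbed into the weight.
  have hsimple : ∀ (f : @SimpleFunc Ω m ℝ) {V : Ω → ℝ≥0∞}, Measurable[m] V →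
      ∫⁻ ω, V ω * ENNReal.ofReal (Real.exp (f ω * ε ω - f ω ^ 2 / 2)) ∂μ ≤ ∫⁻ ω, V ω ∂μ := by
    intro f V hV
    have hpart : ∀ (h : Ω → ℝ≥0∞), Measurable[mΩ] h →
        ∫⁻ ω, h ω ∂μ = ∑ y ∈ @SimpleFunc.range _ _ m f, ∫⁻ ω, (f ⁻¹' {y}).indicator h ω ∂μ := by
      intro h hh
      rw [← lintegral_finsetSum _ fun y _ =>
        hh.indicator (hm _ (@SimpleFunc.measurableSet_fiber _ _ m f y))]
      refine lintegral_congr fun ω => ?_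
      rw [Finset.sum_eq_single (f ω)]
      · simp
      · intro y _ hy
        exact Set.indicator_of_notMem (fun h => hy h.symm) _
      · intro h
        exact absurd (@SimpleFunc.mem_range_self _ _ m f ω) h
    have hfm : Measurable[mΩ] f := (@SimpleFunc.measurable _ _ m _ f).mono hm le_rfl
    have hVm := hV.mono hm le_rfl
    rw [hpart _ (by fun_prop), hpart V hVm]
    refine Finset.sum_le_sum fun y _ => ?_
    refine le_trans (le_of_eq (lintegral_congr fun ω => ?_))
      (lintegral_mul_exp_le_of_condExp_le hm hε (hsub y).1 (hsub y).2
        (hV.indicator (@SimpleFunc.measurableSet_fiber _ _ m f y)))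
    by_cases hω : ω ∈ f ⁻¹' {y}
    · have : f ω = y := hω
      simp [this]
    · simp [Set.indicator_of_notMem hω]
  -- With the compensator `-s² / 2` on the left, the right side does not depend on `s`, so Fatou's
  -- lemma along simple approximations suffices.
  have hnorm : ∀ {V : Ω → ℝ≥0∞}, Measurable[m] V →
      ∫⁻ ω, V ω * ENNReal.ofReal (Real.exp (s ω * ε ω - s ω ^ 2 / 2)) ∂μ ≤ ∫⁻ ω, V ω ∂μ := by
    intro V hV
    have hVm := hV.mono hm le_rfl
    have hss := hs.stronglyMeasurable
    have hlim : ∀ ω, Tendsto (fun k => V ω * ENNReal.ofReal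
        (Real.exp (hss.approx k ω * ε ω - hss.approx k ω ^ 2 / 2))) atTop
        (𝓝 (V ω * ENNReal.ofReal (Real.exp (s ω * ε ω - s ω ^ 2 / 2)))) := by
      intro ω
      have ht := hss.tendsto_approx ω
      refine ENNReal.Tendsto.const_mul (ENNReal.tendsto_ofReal ?_) (Or.inl (by simp [Real.exp_pos]))
      exact (Real.continuous_exp.tendsto _).comp
        ((ht.mul_const _).sub ((ht.pow 2).div_const 2))
    have hmeas : ∀ k, Measurable[mΩ] fun ω => V ω * ENNReal.ofReal
        (Real.exp (hss.approx k ω * ε ω - hss.approx k ω ^ 2 / 2)) := by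
      intro k
      have hfm : Measurable[mΩ] (hss.approx k) :=
        (@SimpleFunc.measurable _ _ m _ (hss.approx k)).mono hm le_rfl
      fun_prop
    calc ∫⁻ ω, V ω * ENNReal.ofReal (Real.exp (s ω * ε ω - s ω ^ 2 / 2)) ∂μ
        = ∫⁻ ω, liminf (fun k => V ω * ENNReal.ofReal
            (Real.exp (hss.approx k ω * ε ω - hss.approx k ω ^ 2 / 2))) atTop ∂μ :=
          lintegral_congr fun ω => (hlim ω).liminf_eq.symm
      _ ≤ liminf (fun k => ∫⁻ ω, V ω * ENNReal.ofReal
            (Real.exp (hss.approx k ω * ε ω - hss.approx k ω ^ 2 / 2)) ∂μ) atTop :=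
          lintegral_liminf_le hmeas
      _ ≤ ∫⁻ ω, V ω ∂μ :=
          (liminf_le_liminf (Eventually.of_forall fun k => hsimple _ hV)).trans_eq (by simp)
  refine le_trans (le_of_eq (lintegral_congr fun ω => ?_)) (hnorm
    (V := fun ω => W ω * ENNReal.ofReal (Real.exp (s ω ^ 2 / 2))) (by fun_prop))
  rw [mul_assoc, ← ENNReal.ofReal_mul (Real.exp_pos _).le, ← Real.exp_add]
  ring_nf

/-- The bound behind the self-normalized supermartingale: the Gaussian average over the
exponent of the conditional sub-Gaussian bound. -/
theorem lintegral_mul_exp_quadratic_le (hm : m ≤ mΩ) (hε : Measurable[mΩ] ε)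
    (hsub : ∀ s : ℝ, Integrable (fun ω => Real.exp (s * ε ω)) μ ∧
      μ[fun ω => Real.exp (s * ε ω) | m] ≤ᵐ[μ] fun _ => Real.exp (s ^ 2 / 2))
    {p q : Ω → ℝ} (hp : Measurable[m] p) (hq : Measurable[m] q) (hq0 : ∀ ω, 0 ≤ q ω)
    {W : Ω → ℝ≥0∞} (hW : Measurable[m] W) :
    ∫⁻ ω, W ω * ENNReal.ofReal (Real.exp
        (p ω / (1 + q ω) * ε ω + q ω / (1 + q ω) * ε ω ^ 2 / 2)) ∂μ ≤
      ∫⁻ ω, W ω * ENNReal.ofReal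
        (√(1 + q ω) * Real.exp (p ω ^ 2 / (1 + q ω) / 2)) ∂μ := by
  have hpm := hp.mono hm le_rfl
  have hqm := hq.mono hm le_rfl
  have hWm := hW.mono hm le_rfl
  -- The random exponent: for fixed `g` it is known at the time of conditioning, and averaging `exp
  -- (S ε)` over standard Gaussian `g` produces the quadratic term in `ε`.
  set S : Ω → ℝ → ℝ := fun ω g => p ω / (1 + q ω) + √(q ω / (1 + q ω)) * g with hS
  have hleft : ∀ ω, W ω * ENNReal.ofReal (Real.exp
      (p ω / (1 + q ω) * ε ω + q ω / (1 + q ω) * ε ω ^ 2 / 2)) =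
      ∫⁻ g, W ω * ENNReal.ofReal (Real.exp (S ω g * ε ω)) ∂(gaussianReal 0 1) := by
    intro ω
    have h0 : 0 ≤ q ω / (1 + q ω) := div_nonneg (hq0 ω) (by linarith [hq0 ω])
    rw [lintegral_const_mul _ (by fun_prop)]
    have : ∀ g, ENNReal.ofReal (Real.exp (S ω g * ε ω)) =
        ENNReal.ofReal (Real.exp (p ω / (1 + q ω) * ε ω)) *
          ENNReal.ofReal (Real.exp (√(q ω / (1 + q ω)) * ε ω * g)) := fun g => by
      rw [← ENNReal.ofReal_mul (Real.exp_pos _).le, ← Real.exp_add]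
      simp only [hS]
      ring_nf
    rw [lintegral_congr this, lintegral_const_mul _ (by fun_prop), lintegral_exp_mul_gaussianReal,
      ← ENNReal.ofReal_mul (Real.exp_pos _).le, ← Real.exp_add, mul_pow, Real.sq_sqrt h0]
  have hright : ∀ ω, W ω * ENNReal.ofReal (√(1 + q ω) * Real.exp (p ω ^ 2 / (1 + q ω) / 2)) =
      ∫⁻ g, W ω * ENNReal.ofReal (Real.exp (S ω g ^ 2 / 2)) ∂(gaussianReal 0 1) := by
    intro ω
    rw [lintegral_const_mul _ (by fun_prop), lintegral_exp_sq_gaussianReal _ (hq0 ω)]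
  rw [lintegral_congr hleft, lintegral_congr hright,
    lintegral_lintegral_swap (by simp only [hS]; fun_prop)]
  refine le_of_le_of_eq (lintegral_mono fun g =>
    lintegral_mul_exp_le_of_measurable hm hε hsub (s := fun ω => S ω g) (by fun_prop) hW) ?_
  exact lintegral_lintegral_swap (by simp only [hS]; fun_prop)

/-- Ville's maximal inequality over a finite horizon for a nonnegative supermartingale with
values in `ℝ≥0∞`. -/
theorem mul_measure_exists_le_le_lintegral {Ω : Type*} {mΩ : MeasurableSpace Ω}
    {μ : Measure Ω} (ℱ : Filtration ℕ mΩ) {D : ℕ → Ω → ℝ≥0∞}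
    (hD : ∀ t, Measurable[ℱ t] (D t))
    (hsuper : ∀ t E, MeasurableSet[ℱ t] E → ∫⁻ ω in E, D (t + 1) ω ∂μ ≤ ∫⁻ ω in E, D t ω ∂μ)
    (c : ℝ≥0∞) (n : ℕ) :
    c * μ {ω | ∃ t ≤ n, c ≤ D t ω} ≤ ∫⁻ ω, D 0 ω ∂μ := by
  have hmeas : ∀ k, MeasurableSet[ℱ k] {ω | ∃ t ≤ k, c ≤ D t ω} := by
    intro k
    have : {ω | ∃ t ≤ k, c ≤ D t ω} = ⋃ t ∈ Finset.range (k + 1), {ω | c ≤ D t ω} := by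
      ext ω; simp
    rw [this]
    refine Finset.measurableSet_biUnion _ fun t ht => ?_
    exact measurableSet_le measurable_const
      ((hD t).mono (ℱ.mono (Nat.lt_succ_iff.1 (Finset.mem_range.1 ht))) le_rfl)
  have hDm : ∀ t, Measurable[mΩ] (D t) := fun t => (hD t).mono (ℱ.le t) le_rfl
  -- The left side bounds from below the mean of the process stopped on first reaching `c`; keeping
  -- the part that has not yet reached `c` makes the induction close.
  suffices h : ∀ k, c * μ {ω | ∃ t ≤ k, c ≤ D t ω} +
      ∫⁻ ω in {ω | ∃ t ≤ k, c ≤ D t ω}ᶜ, D k ω ∂μ ≤ ∫⁻ ω, D 0 ω ∂μ from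
    le_self_add.trans (h n)
  intro k
  induction k with
  | zero =>
    rw [← lintegral_add_compl (μ := μ) (D 0) (ℱ.le 0 _ (hmeas 0))]
    refine add_le_add ?_ le_rfl
    rw [← setLIntegral_const]
    refine setLIntegral_mono (hDm 0) fun ω ⟨t, ht, hω⟩ => ?_
    rwa [Nat.le_zero.1 ht] at hω
  | succ k ih =>
    refine le_trans ?_ ih
    set N := {ω | ∃ t ≤ k, c ≤ D t ω}
    set K := {ω | ∃ t ≤ k + 1, c ≤ D t ω}
    have hNm : MeasurableSet[mΩ] N := ℱ.le k _ (hmeas k)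
    have hKm : MeasurableSet[mΩ] K := ℱ.le (k + 1) _ (hmeas (k + 1))
    have hsub : N ⊆ K := fun ω ⟨t, ht, hω⟩ => ⟨t, ht.trans k.le_succ, hω⟩
    -- Only the paths still below `c` move; they split into those that reach `c` exactly at time `k
    -- + 1` and those that do not.
    have h1 := hsuper k Nᶜ (hmeas k).compl
    rw [← lintegral_inter_add_sdiff (D (k + 1)) Nᶜ hKm] at h1
    have h2 : Nᶜ \ K = Kᶜ := by
      ext ω; exact ⟨fun h => h.2, fun h => ⟨fun hω => h (hsub hω), h⟩⟩
    have h3 : c * μ (Nᶜ ∩ K) ≤ ∫⁻ ω in Nᶜ ∩ K, D (k + 1) ω ∂μ := by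
      rw [← setLIntegral_const]
      refine setLIntegral_mono (hDm _) fun ω ⟨hω, t, ht, hc⟩ => ?_
      rcases ht.eq_or_lt with rfl | ht
      · exact hc
      · exact absurd ⟨t, Nat.lt_succ_iff.1 ht, hc⟩ hω
    have h4 : μ K = μ N + μ (Nᶜ ∩ K) := by
      rw [← measure_inter_add_sdiff K hNm, Set.inter_eq_right.2 hsub, Set.sdiff_eq, Set.inter_comm K]
    rw [h2] at h1
    rw [h4, mul_add, add_assoc]
    gcongr
    exact (add_le_add h3 le_rfl).trans h1

end Probability

namespace LinearBandit

open scoped ENNReal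

variable {Ω 𝒜 : Type*} {d : ℕ} (B : LinearBandit Ω 𝒜 d)

/-- The noise-weighted sum `∑ ε x` of the features of the arms picked before index `t`. -/
noncomputable def noiseSum (play : ℕ → Ω → 𝒜) (t : ℕ) (ω : Ω) : Fin d → ℝ :=
  ∑ i ∈ Finset.range t, B.noise i ω • (B.ctx i ω (play i ω)).ofLp

/-- The self-normalized process `|A|^(-1/2) |lam I|^(1/2) exp (‖∑ ε x‖²_{A⁻¹} / 2)`. -/
noncomputable def selfNormalized (lam : ℝ) (play : ℕ → Ω → 𝒜) (t : ℕ) (ω : Ω) : ℝ :=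
  Real.exp (B.noiseSum play t ω ⬝ᵥ ((B.design lam play t ω)⁻¹ *ᵥ B.noiseSum play t ω) / 2) /
    √((B.design lam play t ω).det / lam ^ d)

/-! ### The design matrix, elliptical potential and ridge estimation error. -/

section Design

variable {lam : ℝ} (play : ℕ → Ω → 𝒜) (t : ℕ) (ω : Ω)

theorem design_succ : B.design lam play (t + 1) ω = B.design lam play t ω +
    Matrix.vecMulVec (B.ctx t ω (play t ω)).ofLp (B.ctx t ω (play t ω)).ofLp := by
  simp only [design, Finset.sum_range_succ, add_assoc]

theorem noiseSum_succ : B.noiseSum play (t + 1) ω = B.noiseSum play t ω +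
    B.noise t ω • (B.ctx t ω (play t ω)).ofLp := by
  simp only [noiseSum, Finset.sum_range_succ]

theorem det_design_zero : (B.design lam play 0 ω).det = lam ^ d := by
  simp [design]

theorem posDef_design (hlam : 0 < lam) : (B.design lam play t ω).PosDef := by
  induction t with
  | zero => simpa [design] using Matrix.PosDef.one.smul hlam
  | succ t ih => rw [design_succ]; exact posDef_add_vecMulVec_self ih _

theorem lam_mul_le_dotProduct_design_mulVec (y : Fin d → ℝ) :
    lam * (y ⬝ᵥ y) ≤ y ⬝ᵥ (B.design lam play t ω *ᵥ y) := by
  induction t with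
  | zero => simp [design, Matrix.smul_mulVec]
  | succ t ih =>
    rw [design_succ, Matrix.add_mulVec, dotProduct_add]
    linarith [dotProduct_mulVec_self_nonneg
      (posSemidef_vecMulVec_self (B.ctx t ω (play t ω)).ofLp) y]

theorem dotProduct_inv_design_mulVec_nonneg (hlam : 0 < lam) (x : Fin d → ℝ) :
    0 ≤ x ⬝ᵥ ((B.design lam play t ω)⁻¹ *ᵥ x) :=
  dotProduct_mulVec_self_nonneg (B.posDef_design play t ω hlam).inv.posSemidef x

theorem dotProduct_inv_design_mulVec_le (hlam : 0 < lam) (x : EuclideanSpace ℝ (Fin d)) :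
    x.ofLp ⬝ᵥ ((B.design lam play t ω)⁻¹ *ᵥ x.ofLp) ≤ ‖x‖ ^ 2 / lam := by
  refine (dotProduct_inv_mulVec_le (B.posDef_design play t ω hlam) hlam
    (B.lam_mul_le_dotProduct_design_mulVec play t ω) x.ofLp).trans_eq ?_
  rw [EuclideanSpace.real_norm_sq_eq]
  simp [dotProduct, sq]

theorem width_nonneg (a : 𝒜) : 0 ≤ B.width lam play t ω a := Real.sqrt_nonneg _

theorem sq_width (hlam : 0 < lam) (a : 𝒜) : B.width lam play t ω a ^ 2 =
    (B.ctx t ω a).ofLp ⬝ᵥ ((B.design lam play t ω)⁻¹ *ᵥ (B.ctx t ω a).ofLp) :=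
  Real.sq_sqrt (B.dotProduct_inv_design_mulVec_nonneg play t ω hlam _)

theorem det_design_succ (hlam : 0 < lam) : (B.design lam play (t + 1) ω).det =
    (B.design lam play t ω).det * (1 + B.width lam play t ω (play t ω) ^ 2) := by
  rw [design_succ, det_add_vecMulVec_self (B.posDef_design play t ω hlam), sq_width _ _ _ _ hlam]

/-- The determinant lemma makes the determinants telescope, which links the widths of the arms
picked to the volume growth. -/
theorem log_det_design_div (hlam : 0 < lam) :
    Real.log ((B.design lam play t ω).det / lam ^ d) =
      ∑ i ∈ Finset.range t, Real.log (1 + B.width lam play i ω (play i ω) ^ 2) := by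
  induction t with
  | zero => rw [det_design_zero, div_self (by positivity)]; simp
  | succ t ih =>
    have := (B.posDef_design play t ω hlam).det_pos
    rw [Finset.sum_range_succ, ← ih, det_design_succ _ _ _ _ hlam, mul_div_right_comm,
      Real.log_mul (by positivity) (by positivity)]

theorem trace_design : (B.design lam play t ω).trace =
    d * lam + ∑ i ∈ Finset.range t, ‖B.ctx i ω (play i ω)‖ ^ 2 := by
  rw [design, Matrix.trace_add, Matrix.trace_sum]
  congr 1
  · simp [mul_comm]
  · refine Finset.sum_congr rfl fun i _ => ?_
    rw [Matrix.trace_vecMulVec, EuclideanSpace.real_norm_sq_eq]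
    simp [dotProduct, sq]

/-- The elliptical potential lemma, in terms of the determinant. -/
theorem log_det_design_div_le (hlam : 0 < lam) {L : ℝ}
    (hL : ∀ i < t, ‖B.ctx i ω (play i ω)‖ ≤ L) :
    Real.log ((B.design lam play t ω).det / lam ^ d) ≤
      d * Real.log (1 + t * L ^ 2 / (d * lam)) := by
  -- In dimension `0` both sides vanish; otherwise the determinant is bounded through the trace,
  -- which is at most `d lam + t L²`.
  rcases Nat.eq_zero_or_pos d with rfl | hd
  · simp
  have : Nonempty (Fin d) := ⟨⟨0, hd⟩⟩
  have hd' : (0 : ℝ) < d := by exact_mod_cast hd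
  have hA := B.posDef_design play t ω hlam
  have hdet := det_le_trace_div_card_pow hA
  rw [Fintype.card_fin, trace_design] at hdet
  have hsum : ∑ i ∈ Finset.range t, ‖B.ctx i ω (play i ω)‖ ^ 2 ≤ t * L ^ 2 := by
    refine (Finset.sum_le_card_nsmul _ _ (L ^ 2) fun i hi => ?_).trans_eq (by simp)
    exact pow_le_pow_left₀ (norm_nonneg _) (hL i (Finset.mem_range.1 hi)) 2
  rw [← Real.log_pow]
  refine Real.log_le_log (div_pos hA.det_pos (by positivity)) ?_
  rw [div_le_iff₀ (by positivity), ← mul_pow]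
  refine hdet.trans (pow_le_pow_left₀ (by positivity) ?_ d)
  rw [div_le_iff₀ hd']
  refine (add_le_add_right hsum _).trans_eq ?_
  field_simp

/-- The elliptical potential lemma. -/
theorem sum_sq_width_le (hlam : 0 < lam) {L : ℝ} (hLlam : L ^ 2 ≤ lam)
    (hL : ∀ i < t, ‖B.ctx i ω (play i ω)‖ ≤ L) :
    ∑ i ∈ Finset.range t, B.width lam play i ω (play i ω) ^ 2 ≤
      2 * (d * Real.log (1 + t * L ^ 2 / (d * lam))) := by
  refine le_trans ?_ (mul_le_mul_of_nonneg_left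
    (B.log_det_design_div_le play t ω hlam hL) zero_le_two)
  rw [log_det_design_div _ _ _ _ hlam, Finset.mul_sum]
  refine Finset.sum_le_sum fun i hi => ?_
  -- Here `L² ≤ lam` enters. For `0 ≤ z ≤ 1` one has `z / 2 ≤ z / (1 + z) ≤ log (1 + z)`, the source
  -- of the factor `2`.
  have hw1 : B.width lam play i ω (play i ω) ^ 2 ≤ 1 := by
    rw [sq_width _ _ _ _ hlam]
    refine (B.dotProduct_inv_design_mulVec_le play i ω hlam _).trans ?_
    rw [div_le_one hlam]
    exact (pow_le_pow_left₀ (norm_nonneg _) (hL i (Finset.mem_range.1 hi)) 2).trans hLlam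
  set z := B.width lam play i ω (play i ω) ^ 2
  have hz0 : 0 ≤ z := sq_nonneg _
  have h := Real.one_sub_inv_le_log_of_pos (show 0 < 1 + z by positivity)
  have h2 : z / 2 ≤ 1 - (1 + z)⁻¹ := by
    have : 1 - (1 + z)⁻¹ = z / (1 + z) := by field_simp; ring
    rw [this]
    exact div_le_div_of_nonneg_left hz0 (by positivity) (by linarith)
  linarith

/-- Applying `A⁻¹` splits the estimation error into the noise part `A⁻¹ S` and the regularization
bias `-lam A⁻¹ θ*`. -/
theorem response_eq :
    (B.response play t ω).ofLp + lam • B.theta.ofLp =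
      B.design lam play t ω *ᵥ B.theta.ofLp + B.noiseSum play t ω := by
  induction t with
  | zero => simp [response, design, noiseSum, Matrix.smul_mulVec]
  | succ t ih =>
    have hr : (B.response play (t + 1) ω).ofLp = (B.response play t ω).ofLp +
        B.reward play t ω • (B.ctx t ω (play t ω)).ofLp := by
      simp [response, Finset.sum_range_succ]
    have hi : inner ℝ B.theta (B.ctx t ω (play t ω)) =
        (B.ctx t ω (play t ω)).ofLp ⬝ᵥ B.theta.ofLp := by
      rw [EuclideanSpace.inner_eq_star_dotProduct]; simp
    rw [hr, add_right_comm, ih, design_succ, noiseSum_succ, Matrix.add_mulVec,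
      Matrix.vecMulVec_mulVec, reward, hi]
    ext j
    simp only [Pi.add_apply, Pi.smul_apply, smul_eq_mul, MulOpposite.smul_eq_mul_unop,
      MulOpposite.unop_op]
    ring

/-- The confidence ellipsoid, in terms of the noise term. -/
theorem abs_inner_estimate_sub_le (hlam : 0 < lam) (a : 𝒜) :
    |inner ℝ (B.estimate lam play t ω) (B.ctx t ω a) - inner ℝ B.theta (B.ctx t ω a)| ≤
      (√lam * ‖B.theta‖ +
        √(B.noiseSum play t ω ⬝ᵥ ((B.design lam play t ω)⁻¹ *ᵥ B.noiseSum play t ω))) *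
        B.width lam play t ω a := by
  have hA := B.posDef_design play t ω hlam
  set A := B.design lam play t ω with hAdef
  set S := B.noiseSum play t ω
  set x := B.ctx t ω a
  have hest : (B.estimate lam play t ω).ofLp =
      B.theta.ofLp + A⁻¹ *ᵥ S - lam • (A⁻¹ *ᵥ B.theta.ofLp) := by
    have h := B.response_eq (lam := lam) play t ω
    rw [← eq_sub_iff_add_eq] at h
    simp only [estimate]
    rw [h, ← hAdef, Matrix.mulVec_sub, Matrix.mulVec_add, inv_mulVec_mulVec hA, Matrix.mulVec_smul]
  have heq : inner ℝ (B.estimate lam play t ω) x - inner ℝ B.theta x =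
      x.ofLp ⬝ᵥ (A⁻¹ *ᵥ S) - lam * (x.ofLp ⬝ᵥ (A⁻¹ *ᵥ B.theta.ofLp)) := by
    rw [EuclideanSpace.inner_eq_star_dotProduct, EuclideanSpace.inner_eq_star_dotProduct, hest]
    simp only [star_trivial, dotProduct_add, dotProduct_sub, dotProduct_smul, smul_eq_mul]
    ring
  have hcs : ∀ y : Fin d → ℝ, |x.ofLp ⬝ᵥ (A⁻¹ *ᵥ y)| ≤
      √(y ⬝ᵥ (A⁻¹ *ᵥ y)) * B.width lam play t ω a := by
    intro y
    rw [width, weightedNorm, ← Real.sqrt_mul (dotProduct_mulVec_self_nonneg hA.inv.posSemidef _)]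
    refine Real.abs_le_sqrt ((sq_dotProduct_mulVec_le hA.inv.posSemidef _ _).trans_eq ?_)
    rw [mul_comm]
  -- The bias term, bounded by `A⁻¹ ≤ lam⁻¹ I`.
  have hθ : lam * √(B.theta.ofLp ⬝ᵥ (A⁻¹ *ᵥ B.theta.ofLp)) ≤ √lam * ‖B.theta‖ := by
    have h : √(B.theta.ofLp ⬝ᵥ (A⁻¹ *ᵥ B.theta.ofLp)) ≤ ‖B.theta‖ / √lam := by
      refine (Real.sqrt_le_sqrt (B.dotProduct_inv_design_mulVec_le play t ω hlam B.theta)).trans_eq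
        ?_
      rw [Real.sqrt_div (by positivity), Real.sqrt_sq (norm_nonneg _)]
    refine (mul_le_mul_of_nonneg_left h hlam.le).trans_eq ?_
    have hs : √lam ≠ 0 := by positivity
    field_simp
    rw [Real.sq_sqrt hlam.le, mul_comm]
  have hw := B.width_nonneg (lam := lam) play t ω a
  rw [heq]
  calc |x.ofLp ⬝ᵥ (A⁻¹ *ᵥ S) - lam * (x.ofLp ⬝ᵥ (A⁻¹ *ᵥ B.theta.ofLp))|
      ≤ |x.ofLp ⬝ᵥ (A⁻¹ *ᵥ S)| + |lam * (x.ofLp ⬝ᵥ (A⁻¹ *ᵥ B.theta.ofLp))| := abs_sub _ _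
    _ ≤ √(S ⬝ᵥ (A⁻¹ *ᵥ S)) * B.width lam play t ω a +
        lam * (√(B.theta.ofLp ⬝ᵥ (A⁻¹ *ᵥ B.theta.ofLp)) * B.width lam play t ω a) := by
        rw [abs_mul, abs_of_pos hlam]
        exact add_le_add (hcs S) (mul_le_mul_of_nonneg_left (hcs _) hlam.le)
    _ ≤ _ := by nlinarith [mul_le_mul_of_nonneg_right hθ hw]

theorem selfNormalized_nonneg : 0 ≤ B.selfNormalized lam play t ω := by
  unfold selfNormalized; positivity

theorem selfNormalized_zero (hlam : 0 < lam) : B.selfNormalized lam play 0 ω = 1 := by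
  rw [selfNormalized, det_design_zero, div_self (by positivity)]
  simp [noiseSum]

/-- Separates what is known before the noise of index `t` from the factor containing it, in the form
that `lintegral_mul_exp_quadratic_le` averages; the divisor is exactly the bound obtained there. -/
theorem selfNormalized_succ (hlam : 0 < lam) :
    B.selfNormalized lam play (t + 1) ω =
      let x := (B.ctx t ω (play t ω)).ofLp
      let p := x ⬝ᵥ ((B.design lam play t ω)⁻¹ *ᵥ B.noiseSum play t ω)
      let q := x ⬝ᵥ ((B.design lam play t ω)⁻¹ *ᵥ x)
      B.selfNormalized lam play t ω / (√(1 + q) * Real.exp (p ^ 2 / (1 + q) / 2)) *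
        Real.exp (p / (1 + q) * B.noise t ω + q / (1 + q) * B.noise t ω ^ 2 / 2) := by
  have hA := B.posDef_design play t ω hlam
  have hq := B.dotProduct_inv_design_mulVec_nonneg play t ω hlam (B.ctx t ω (play t ω)).ofLp
  have hdet := hA.det_pos
  simp only [selfNormalized]
  rw [design_succ, noiseSum_succ, dotProduct_inv_add_vecMulVec_mulVec hA,
    det_add_vecMulVec_self hA, mul_div_right_comm, Real.sqrt_mul (by positivity)]
  set x := (B.ctx t ω (play t ω)).ofLp
  set A := B.design lam play t ω
  set S := B.noiseSum play t ω
  set q := x ⬝ᵥ (A⁻¹ *ᵥ x)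
  set p := x ⬝ᵥ (A⁻¹ *ᵥ S)
  have hexp : (S ⬝ᵥ (A⁻¹ *ᵥ S) - p ^ 2 / (1 + q) + 2 * (p / (1 + q) * B.noise t ω) +
      q / (1 + q) * B.noise t ω ^ 2) / 2 = S ⬝ᵥ (A⁻¹ *ᵥ S) / 2 - p ^ 2 / (1 + q) / 2 +
      (p / (1 + q) * B.noise t ω + q / (1 + q) * B.noise t ω ^ 2 / 2) := by ring
  rw [hexp, Real.exp_add, Real.exp_sub]
  field_simp

/-- Where the self-normalized process stays below `1 / δ`, the true coefficient vector lies in the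
confidence ellipsoid. -/
theorem abs_inner_estimate_sub_le_confRadius (hlam : 0 < lam) {δ : ℝ} (hδ : 0 < δ)
    (h : B.selfNormalized lam play t ω < 1 / δ) (a : 𝒜) :
    |inner ℝ (B.estimate lam play t ω) (B.ctx t ω a) - inner ℝ B.theta (B.ctx t ω a)| ≤
      B.confRadius lam δ play t ω * B.width lam play t ω a := by
  refine (B.abs_inner_estimate_sub_le play t ω hlam a).trans
    (mul_le_mul_of_nonneg_right ?_ (B.width_nonneg play t ω a))
  have hdet := (B.posDef_design play t ω hlam).det_pos
  rw [confRadius]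
  refine add_le_add_right (Real.sqrt_le_sqrt ?_) _
  -- Taking logarithms, `D < 1 / δ` reads `‖S‖²_{A⁻¹} / 2 < log (√(|A| / lam^d) / δ)`.
  rw [selfNormalized, div_lt_iff₀ (by positivity), one_div_mul_eq_div] at h
  have := (Real.lt_log_iff_exp_lt (by positivity)).2 h
  linarith

end Design

/-! ### Measurability and the self-normalized supermartingale. -/

section Concentration

variable [Fintype 𝒜] [mΩ : MeasurableSpace Ω] {μ : Measure Ω} [IsProbabilityMeasure μ]
  {ℱ : Filtration ℕ mΩ} {α : ℕ → Ω → ℝ} {play : ℕ → Ω → 𝒜} {B}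

theorem Adapted.measurable_ctx_play (h : B.Adapted ℱ α play) (t : ℕ) (j : Fin d) :
    Measurable[ℱ t] fun ω => (B.ctx t ω (play t ω)).ofLp j := by
  classical
  -- Finiteness of the arm set makes the feature of the random arm a finite sum of measurable
  -- pieces.
  have heq : (fun ω => (B.ctx t ω (play t ω)).ofLp j) = fun ω => ∑ a,
      {ω | play t ω = a}.indicator (fun ω => (B.ctx t ω a).ofLp j) ω := by
    ext ω
    simp [Set.indicator_apply]
  rw [heq]
  refine Finset.measurable_fun_sum _ fun a _ => Measurable.indicator ?_ (h.play t a)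
  have := h.ctx t a
  fun_prop

theorem Adapted.measurable_design_apply (h : B.Adapted ℱ α play) (lam : ℝ) (t : ℕ)
    (i j : Fin d) : Measurable[ℱ t] fun ω => B.design lam play t ω i j := by
  induction t with
  | zero => simp [design]
  | succ t ih =>
    simp only [design_succ, Matrix.add_apply, Matrix.vecMulVec_apply]
    have hle := ℱ.mono t.le_succ
    exact (ih.mono hle le_rfl).add (((h.measurable_ctx_play t i).mono hle le_rfl).mul
      ((h.measurable_ctx_play t j).mono hle le_rfl))

theorem Adapted.measurable_noiseSum_apply (h : B.Adapted ℱ α play) (t : ℕ) (j : Fin d) :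
    Measurable[ℱ t] fun ω => B.noiseSum play t ω j := by
  induction t with
  | zero => simp [noiseSum]
  | succ t ih =>
    simp only [noiseSum_succ, Pi.add_apply, Pi.smul_apply, smul_eq_mul]
    have hle := ℱ.mono t.le_succ
    exact (ih.mono hle le_rfl).add
      ((h.noise t).mul ((h.measurable_ctx_play t j).mono hle le_rfl))

theorem Adapted.measurable_selfNormalized (h : B.Adapted ℱ α play) (lam : ℝ) (t : ℕ) :
    Measurable[ℱ t] (B.selfNormalized lam play t) := by
  have h1 : Measurable[ℱ t] fun ω => B.noiseSum play t ω ⬝ᵥ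
      ((B.design lam play t ω)⁻¹ *ᵥ B.noiseSum play t ω) :=
    measurable_dotProduct_mulVec (fun i j => measurable_inv_apply (h.measurable_design_apply lam t)
      i j) (h.measurable_noiseSum_apply t) (h.measurable_noiseSum_apply t)
  have h2 : Measurable[ℱ t] fun ω => (B.design lam play t ω).det :=
    measurable_det_of_apply (h.measurable_design_apply lam t)
  unfold selfNormalized
  fun_prop

/-- The self-normalized process is a supermartingale. -/
theorem setLIntegral_selfNormalized_succ_le (h : B.Adapted ℱ α play)
    (hnoise : CondSubGaussian μ ℱ B.noise) {lam : ℝ} (hlam : 0 < lam) (t : ℕ) {E : Set Ω}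
    (hE : MeasurableSet[ℱ t] E) :
    ∫⁻ ω in E, ENNReal.ofReal (B.selfNormalized lam play (t + 1) ω) ∂μ ≤
      ∫⁻ ω in E, ENNReal.ofReal (B.selfNormalized lam play t ω) ∂μ := by
  have hx := h.measurable_ctx_play t
  have hS := h.measurable_noiseSum_apply t
  have hP := fun i j => measurable_inv_apply (h.measurable_design_apply lam t) i j
  set p : Ω → ℝ := fun ω => (B.ctx t ω (play t ω)).ofLp ⬝ᵥ
    ((B.design lam play t ω)⁻¹ *ᵥ B.noiseSum play t ω) with hp
  set q : Ω → ℝ := fun ω => (B.ctx t ω (play t ω)).ofLp ⬝ᵥ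
    ((B.design lam play t ω)⁻¹ *ᵥ (B.ctx t ω (play t ω)).ofLp) with hq
  have hpm : Measurable[ℱ t] p := measurable_dotProduct_mulVec hP hx hS
  have hqm : Measurable[ℱ t] q := measurable_dotProduct_mulVec hP hx hx
  have hDm := h.measurable_selfNormalized lam t
  have hq0 : ∀ ω, 0 ≤ q ω := fun ω => B.dotProduct_inv_design_mulVec_nonneg play t ω hlam _
  -- The weight is the known factor of the update, restricted to `E`; its denominator cancels
  -- against the Gaussian average.
  let W : Ω → ℝ≥0∞ := E.indicator fun ω => ENNReal.ofReal
    (B.selfNormalized lam play t ω / (√(1 + q ω) * Real.exp (p ω ^ 2 / (1 + q ω) / 2)))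
  have hW : Measurable[ℱ t] W := Measurable.indicator (by fun_prop) hE
  rw [← lintegral_indicator (ℱ.le t _ hE), ← lintegral_indicator (ℱ.le t _ hE)]
  refine le_of_eq_of_le (lintegral_congr fun ω => ?_) (le_of_le_of_eq
    (lintegral_mul_exp_quadratic_le (ℱ.le t) ((h.noise t).mono (ℱ.le _) le_rfl) (hnoise t)
      hpm hqm hq0 hW) (lintegral_congr fun ω => ?_))
  · by_cases hω : ω ∈ E
    · simp only [W, Set.indicator_of_mem hω]
      rw [selfNormalized_succ _ _ _ _ hlam, ← ENNReal.ofReal_mul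
        (div_nonneg (B.selfNormalized_nonneg _ _ _) (by positivity))]
    · simp [W, Set.indicator_of_notMem hω]
  · by_cases hω : ω ∈ E
    · simp only [W, Set.indicator_of_mem hω]
      have h0 : 0 < 1 + q ω := by linarith [hq0 ω]
      rw [← ENNReal.ofReal_mul
        (div_nonneg (B.selfNormalized_nonneg _ _ _) (by positivity)),
        div_mul_cancel₀ _ (by positivity)]
    · simp [W, Set.indicator_of_notMem hω]

/-- The self-normalized concentration inequality. -/
theorem one_sub_le_measureReal_selfNormalized_lt (h : B.Adapted ℱ α play)
    (hnoise : CondSubGaussian μ ℱ B.noise) {lam : ℝ} (hlam : 0 < lam) {δ : ℝ} (hδ : 0 < δ)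
    (n : ℕ) :
    1 - δ ≤ μ.real {ω | ∀ t ≤ n, B.selfNormalized lam play t ω < 1 / δ} := by
  have hv := mul_measure_exists_le_le_lintegral (μ := μ) ℱ
    (D := fun t ω => ENNReal.ofReal (B.selfNormalized lam play t ω))
    (fun t => (h.measurable_selfNormalized lam t).ennreal_ofReal)
    (fun t E hE => setLIntegral_selfNormalized_succ_le h hnoise hlam t hE)
    (ENNReal.ofReal (1 / δ)) n
  simp only [selfNormalized_zero _ _ _ hlam, ENNReal.ofReal_one, lintegral_const, measure_univ,
    mul_one] at hv
  have hset : {ω | ∃ t ≤ n, ENNReal.ofReal (1 / δ) ≤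
      ENNReal.ofReal (B.selfNormalized lam play t ω)} =
      {ω | ∀ t ≤ n, B.selfNormalized lam play t ω < 1 / δ}ᶜ := by
    ext ω
    simp only [Set.mem_ofPred_eq, Set.mem_compl_iff, not_forall, not_lt, exists_prop,
      ENNReal.ofReal_le_ofReal_iff (B.selfNormalized_nonneg _ _ _)]
  rw [hset] at hv
  set G := {ω | ∀ t ≤ n, B.selfNormalized lam play t ω < 1 / δ}
  have hv' : (1 / δ) * μ.real Gᶜ ≤ 1 := by
    have := ENNReal.toReal_mono ENNReal.one_ne_top hv
    rwa [ENNReal.toReal_mul, ENNReal.toReal_ofReal (by positivity), ENNReal.toReal_one] at this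
  rw [one_div_mul_eq_div, div_le_one hδ] at hv'
  have hu : μ.real (G ∪ Gᶜ) ≤ μ.real G + μ.real Gᶜ := measureReal_union_le _ _
  rw [Set.union_compl_self, probReal_univ] at hu
  linarith

end Concentration

/-! ### Range of the fairness penalty. -/

section Penalty

variable {B} {play : ℕ → Ω → 𝒜} {ω : Ω} {t : ℕ}

theorem sum_div_card_mem_Icc {ι : Type*} (I : Finset ι) {f : ι → ℝ}
    (h : ∀ i ∈ I, f i ∈ Set.Icc (0 : ℝ) 1) : (∑ i ∈ I, f i) / (I.card : ℝ) ∈ Set.Icc (0 : ℝ) 1 :=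
  ⟨div_nonneg (Finset.sum_nonneg fun i hi => (h i hi).1) (Nat.cast_nonneg _),
    div_le_one_of_le₀ ((Finset.sum_le_card_nsmul _ _ 1 fun i hi => (h i hi).2).trans_eq (by simp))
      (Nat.cast_nonneg _)⟩

/-- Both group means lie in `[0,1]`, the default `0` for an empty mean included, so they differ by
at most `1`. -/
theorem abs_penalty_le_one (h : ∀ i < t, B.reward play i ω ∈ Set.Icc (0 : ℝ) 1) (a : 𝒜) :
    |B.penalty play t ω a| ≤ 1 := by
  classical
  have hmean : ∀ s, B.armGroupMean play s a t ω ∈ Set.Icc (0 : ℝ) 1 := fun s =>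
    sum_div_card_mem_Icc _ fun i hi => h i (Finset.mem_range.1 (Finset.mem_filter.1 hi).1)
  have hsign : ∀ r : ℝ, |-Real.sign r| ≤ 1 := fun r => by
    rcases Real.sign_apply_eq r with h | h | h <;> simp [h]
  rw [penalty, abs_mul]
  refine mul_le_one₀ (hsign _) (abs_nonneg _) (abs_sub_le_iff.2 ⟨?_, ?_⟩) <;>
  linarith [(hmean true).1, (hmean true).2, (hmean false).1, (hmean false).2]

theorem minWidth_nonneg (lam : ℝ) : 0 ≤ B.minWidth lam play t ω :=
  (Finset.le_inf'_iff _ _).2 fun a _ => B.width_nonneg play t ω a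

theorem scaledPenalty_mem_Icc (h : ∀ i < t, B.reward play i ω ∈ Set.Icc (0 : ℝ) 1)
    {γ : ℝ} (hγ : 0 ≤ γ) {α : ℕ → Ω → ℝ} (hα : 0 ≤ α t ω) (lam : ℝ) (a : 𝒜) :
    B.scaledPenalty lam γ α play t ω a ∈ Set.Icc 0 (γ * α t ω * B.minWidth lam play t ω) := by
  have hp := abs_le.1 (abs_penalty_le_one h a)
  have hw := minWidth_nonneg (B := B) (play := play) (t := t) (ω := ω) lam
  have hc : 0 ≤ α t ω * B.minWidth lam play t ω * γ := by positivity
  rw [scaledPenalty]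
  constructor
  · have := mul_nonneg hc (show 0 ≤ B.penalty play t ω a + 1 by linarith)
    linarith
  · have := mul_le_mul_of_nonneg_left (show B.penalty play t ω a + 1 ≤ 2 by linarith) hc
    linarith

end Penalty

/-! ### From confidence ellipsoids to the regret bound. -/

section Regret

variable {B} {play : ℕ → Ω → 𝒜} {ω : Ω} {t T : ℕ} {lam γ δ : ℝ} {α : ℕ → Ω → ℝ}

/-- The regret of one round of Fair-LinUCB inside the confidence ellipsoid. -/
theorem instantaneous_regret_le (hγ : 0 ≤ γ) (hα : 0 ≤ α t ω)
    (hr : ∀ i < t, B.reward play i ω ∈ Set.Icc (0 : ℝ) 1)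
    (hconf : ∀ a, |inner ℝ (B.estimate lam play t ω) (B.ctx t ω a) -
      inner ℝ B.theta (B.ctx t ω a)| ≤ α t ω * B.width lam play t ω a)
    (hmem : play t ω ∈ B.arms t ω)
    (hmax : ∀ a ∈ B.arms t ω, B.score lam γ α play t ω a ≤ B.score lam γ α play t ω (play t ω)) :
    (B.arms t ω).sup' (B.arms_nonempty t ω) (fun a => inner ℝ B.theta (B.ctx t ω a)) -
      inner ℝ B.theta (B.ctx t ω (play t ω)) ≤
      (2 + γ) * (α t ω * B.width lam play t ω (play t ω)) := by
  rw [sub_le_iff_le_add, Finset.sup'_le_iff]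
  intro a ha
  have h1 := (abs_le.1 (hconf a)).1
  have h2 := (abs_le.1 (hconf (play t ω))).2
  have h3 := hmax a ha
  have h4 := (scaledPenalty_mem_Icc hr hγ hα lam a).1
  have h5 := (scaledPenalty_mem_Icc hr hγ hα lam (play t ω)).2
  have h6 : B.minWidth lam play t ω ≤ B.width lam play t ω (play t ω) := Finset.inf'_le _ hmem
  have h7 := mul_le_mul_of_nonneg_left h6 (mul_nonneg hγ hα)
  simp only [score] at h3
  -- The chain is: mean of `a`, at most its score, at most the score of the arm picked, at most the
  -- mean of that arm plus two confidence widths plus its penalty.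
  linarith

/-- The regret of Fair-LinUCB inside the confidence ellipsoids. -/
theorem regret_le {L Γ R : ℝ} (hlam : 0 < lam) (hlamL : L ^ 2 ≤ lam) (hγ : 0 ≤ γ) (hΓ : γ ≤ Γ)
    (hL : ∀ i < T, ‖B.ctx i ω (play i ω)‖ ≤ L)
    (hr : ∀ i < T, B.reward play i ω ∈ Set.Icc (0 : ℝ) 1)
    (hα : ∀ t < T, 0 ≤ α t ω) (hαR : ∀ t < T, α t ω ≤ R) (hR : 0 ≤ R)
    (hconf : ∀ t < T, ∀ a, |inner ℝ (B.estimate lam play t ω) (B.ctx t ω a) -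
      inner ℝ B.theta (B.ctx t ω a)| ≤ α t ω * B.width lam play t ω a)
    (hplay : B.IsFairLinUCB lam γ α T play) :
    B.regret play T ω ≤ √(2 * T * d * Real.log (1 + T * L ^ 2 / (d * lam))) * ((2 + Γ) * R) := by
  have hround : B.regret play T ω ≤
      ∑ t ∈ Finset.range T, ((2 + Γ) * R) * B.width lam play t ω (play t ω) := by
    refine Finset.sum_le_sum fun t ht => ?_
    have ht := Finset.mem_range.1 ht
    refine (instantaneous_regret_le hγ (hα t ht) (fun i hi => hr i (hi.trans ht)) (hconf t ht)
      (hplay t ht ω).1 (hplay t ht ω).2).trans ?_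
    have hw := B.width_nonneg (lam := lam) play t ω (play t ω)
    rw [mul_assoc]
    exact mul_le_mul (by linarith) (mul_le_mul_of_nonneg_right (hαR t ht) hw)
      (mul_nonneg (hα t ht) hw) (by linarith)
  refine hround.trans ?_
  rw [← Finset.mul_sum, mul_comm]
  refine mul_le_mul_of_nonneg_right (Real.le_sqrt_of_sq_le ?_)
    (mul_nonneg (by linarith) hR)
  -- Cauchy–Schwarz over the `T` rounds.
  refine sq_sum_le_card_mul_sum_sq.trans ?_
  rw [Finset.card_range]
  refine (mul_le_mul_of_nonneg_left (B.sum_sq_width_le play T ω hlam hlamL hL)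
    (Nat.cast_nonneg T)).trans_eq ?_
  ring

end Regret

end LinearBandit

end FairBandit

theorem theorem1 {Ω 𝒜 : Type*} [mΩ : MeasurableSpace Ω] [Fintype 𝒜] (μ : Measure Ω)
    [IsProbabilityMeasure μ] (ℱ : Filtration ℕ mΩ) {d : ℕ} (T : ℕ)
    (B : FairBandit.LinearBandit Ω 𝒜 d) (lam L M γ Γ δ : ℝ)
    (α : ℕ → Ω → ℝ) (play : ℕ → Ω → 𝒜)
    (hadapted : B.Adapted ℱ α play)
    (hnoise : FairBandit.CondSubGaussian μ ℱ B.noise)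
    (hctx : ∀ t ω, ∀ a ∈ B.arms t ω, ‖B.ctx t ω a‖ < L)
    (htheta : ‖B.theta‖ < M)
    (hreward : ∀ᵐ ω ∂μ, ∀ t < T, B.reward play t ω ∈ Set.Icc (0 : ℝ) 1)
    (hlam : 0 < lam) (hlamL : L ^ 2 ≤ lam)
    (hγ : 0 ≤ γ) (hΓ : γ ≤ Γ) (hδ : δ ∈ Set.Ioo (0 : ℝ) 1)
    (hα_mono : ∀ ω, Monotone fun t => α t ω) (hα_one : ∀ ω, 1 ≤ α 0 ω)
    (hα_lower : ∀ t < T, ∀ ω, B.confRadius lam δ play t ω ≤ α t ω)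
    (hα_upper : ∀ t < T, ∀ ω, α t ω ≤ FairBandit.finalRadius d T lam L M δ)
    (hplay : B.IsFairLinUCB lam γ α T play) :
    (∀ᵐ ω ∂μ, ∀ t < T, ∀ a ∈ B.arms t ω,
      B.scaledPenalty lam γ α play t ω a ∈
        Set.Icc 0 (γ * α t ω * B.minWidth lam play t ω)) ∧
    1 - δ ≤ μ.real {ω | B.regret play T ω ≤
      √(2 * T * d * Real.log (1 + T * L ^ 2 / (d * lam))) *
        ((2 + Γ) * (√lam * M +
          √(2 * Real.log (1 / δ) + d * Real.log (1 + T * L ^ 2 / (d * lam)))))} := by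
  have hα_pos : ∀ t ω, 0 ≤ α t ω := fun t ω =>
    zero_le_one.trans ((hα_one ω).trans (hα_mono ω t.zero_le))
  refine ⟨?_, ?_⟩
  · filter_upwards [hreward] with ω hω t ht a _
    exact FairBandit.LinearBandit.scaledPenalty_mem_Icc (fun i hi => hω i (hi.trans ht)) hγ
      (hα_pos t ω) lam a
  · refine (FairBandit.LinearBandit.one_sub_le_measureReal_selfNormalized_lt hadapted hnoise hlam
      -- Rewards lie in `[0,1]` only almost surely, so the concentration event is contained in the
      -- regret event up to a null set.
      hδ.1 T).trans (ENNReal.toReal_mono (measure_ne_top _ _) (measure_mono_ae ?_))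
    filter_upwards [hreward] with ω hr hG
    have hM : 0 ≤ M := (norm_nonneg _).trans htheta.le
    refine FairBandit.LinearBandit.regret_le hlam hlamL hγ hΓ
      (fun i hi => (hctx i ω _ (hplay i hi ω).1).le) hr (fun t _ => hα_pos t ω)
      (fun t ht => hα_upper t ht ω) (by positivity) (fun t ht a => ?_) hplay
    exact (B.abs_inner_estimate_sub_le_confRadius play t ω hlam hδ.1 (hG t ht.le) a).trans
      (mul_le_mul_of_nonneg_right (hα_lower t ht ω) (B.width_nonneg play t ω a))
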